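/- For permutations $q\in S_k$ and $p\in S_n$ in one-line notation, an occurrence of the pattern $q$ in $p$ is a choice of indices $i_1<\dots<i_k$ such that $p_{i_1}\cdots p_{i_k}$ is in the same relative order as $q_1\cdots q_k$; $p$ avoids $q$ if there is no such occurrence. Let $\mathrm{Av}_n(123)$ be the set of permutations in $S_n$ that avoid $123$, and let $d_n=f_{321}(\mathrm{Av}_n(123))$ be the total number of occurrences of the pattern $321$ in all permutations of $\mathrm{Av}_n(123)$. Then, as formal power series over $\mathbb{Q}$, $$\sum_{n\ge 0} d_n x^n=\frac{1}{2x}\left(\frac{8x^3-20x^2+8x-1}{(1-4x)^2}-\frac{36x^3-34x^2+10x-1}{(1-4x)^{5/2}}\right),$$ where $(1-4x)^{5/2}=\left(\sqrt{1-4x}\right)^5$ and $\sqrt{1-4x}$ is the square root of $1-4x$ with constant term $1$. Here division by $2x$ means that the series in parentheses equals $2x\sum_{n\ge 0} d_n x^n$. -/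

import Mathlib

/-- Increasing positions `f 0 < f 1 < ⋯` of `p` at which the entries of `p` are in the same
relative order as the entries of `q`. -/
def IsOccurrence {k n : ℕ} (q : Equiv.Perm (Fin k)) (p : Equiv.Perm (Fin n))
    (f : Fin k → Fin n) : Prop :=
  (∀ i j, i < j → f i < f j) ∧ ∀ i j, q i < q j ↔ p (f i) < p (f j)

instance {k n : ℕ} (q : Equiv.Perm (Fin k)) (p : Equiv.Perm (Fin n)) :
    DecidablePred (IsOccurrence q p) := fun f => by
  unfold IsOccurrence; infer_instance

/-- The number of occurrences of the pattern `q` in the permutation `p`. -/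
def patternCount {k n : ℕ} (q : Equiv.Perm (Fin k)) (p : Equiv.Perm (Fin n)) : ℕ :=
  (Finset.univ.filter (fun f : Fin k → Fin n => IsOccurrence q p f)).card

/-- `p` contains `q` as a pattern. -/
def ContainsPattern {k n : ℕ} (q : Equiv.Perm (Fin k)) (p : Equiv.Perm (Fin n)) : Prop :=
  ∃ f : Fin k → Fin n, IsOccurrence q p f

instance {k n : ℕ} (q : Equiv.Perm (Fin k)) :
    DecidablePred (fun p : Equiv.Perm (Fin n) => ContainsPattern q p) := fun p => by
  unfold ContainsPattern; infer_instance

/-- The set of permutations of length `n` that avoid `q`. -/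
def avoiders {k : ℕ} (n : ℕ) (q : Equiv.Perm (Fin k)) : Finset (Equiv.Perm (Fin n)) :=
  Finset.univ.filter (fun p => ¬ ContainsPattern q p)

/-- The total number of occurrences of `q` in the permutations of the set `C`. -/
def totalPatternCount {k n : ℕ} (q : Equiv.Perm (Fin k)) (C : Finset (Equiv.Perm (Fin n))) : ℕ :=
  ∑ p ∈ C, patternCount q p

/-- The permutation `123` in one-line notation. -/
def perm123 : Equiv.Perm (Fin 3) := Equiv.refl (Fin 3)

/-- The permutation `321` in one-line notation. -/
def perm321 : Equiv.Perm (Fin 3) := Fin.revPerm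

/-- The formal power series `√(1 - 4x)` over `ℚ`, that is, the binomial series `(1 + y)^(1/2)`
at `y = -4x`. -/
noncomputable def sqrtOneSubFourX : PowerSeries ℚ :=
  PowerSeries.rescale (-4 : ℚ) (PowerSeries.binomialSeries ℚ (1 / 2 : ℚ))

/-- `√(1 - 4x)` is indeed a square root of `1 - 4x`. -/
theorem sqrtOneSubFourX_sq :
    sqrtOneSubFourX ^ 2 = 1 - 4 * (PowerSeries.X : PowerSeries ℚ) := by
  have h : (PowerSeries.binomialSeries ℚ (1 / 2 : ℚ)) ^ 2 = 1 + PowerSeries.X := by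
    rw [sq, ← PowerSeries.binomialSeries_add]
    have := PowerSeries.binomialSeries_nat (R := ℚ) (A := ℚ) 1
    norm_num at this ⊢
    exact this
  have h4 : (PowerSeries.C (-4 : ℚ)) = -(4 : PowerSeries ℚ) := by
    rw [map_neg]; rfl
  rw [sqrtOneSubFourX, ← map_pow, h, map_add, map_one, PowerSeries.rescale_X, h4]
  ring

/-- `√(1 - 4x)` is the square root whose constant term is `1`. -/
theorem constantCoeff_sqrtOneSubFourX : PowerSeries.constantCoeff sqrtOneSubFourX = 1 := by
  rw [sqrtOneSubFourX, ← PowerSeries.coeff_zero_eq_constantCoeff_apply, PowerSeries.coeff_rescale]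
  simp

/-! ### Occurrences of patterns of length three -/

/-! For positions i < j < k let a, b, c indicate that the pairs (i,j), (i,k), (j,k) are ascents. The
indicator of 321 is (1-a)(1-b)(1-c), and avoiding 123 means ac = 0, so it equals 1 - (a+b+c) + ab +
bc. With r the number of larger entries to the right and l the number of smaller entries to the
left, the count of 321 is thus C(n,3) - (n-2)Σr + ΣC(r,2) + ΣC(l,2)
(`patternCount_perm321_of_avoids`). Reverse complement exchanges l and r, so only the number of
avoiders and the totals of r and r² are needed.

Avoiders grow by prepending a first entry. Label an avoider p of length n by k = n - `ascentBound
p`: its children have labels k+1 and 1, …, k, and the new entry has r = 0 in the first case and r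
equal to the new label in the others (`sum_avoids123_succ`). The totals are therefore weighted path
counts in the Catalan generating tree. Their generating functions are powers of the Catalan series
C, times x and a polynomial in the label for the weighted ones (`coeff_eq_treeWeight_of_factor`).
Factors of n become derivatives, and `closed_form_identity` simplifies the result. -/

theorem isOccurrence_perm321_iff {n : ℕ} (p : Equiv.Perm (Fin n)) (f : Fin 3 → Fin n) :
    IsOccurrence perm321 p f ↔ f 0 < f 1 ∧ f 1 < f 2 ∧ p (f 1) < p (f 0) ∧ p (f 2) < p (f 1) := by
  have h10 : perm321 1 < perm321 0 := by decide
  have h21 : perm321 2 < perm321 1 := by decide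
  constructor
  · rintro ⟨h, h'⟩
    exact ⟨h 0 1 (by decide), h 1 2 (by decide), (h' 1 0).1 h10, (h' 2 1).1 h21⟩
  · rintro ⟨h1, h2, h3, h4⟩
    have h01 : ¬ perm321 0 < perm321 1 := by decide
    have h02 : ¬ perm321 0 < perm321 2 := by decide
    have h12 : ¬ perm321 1 < perm321 2 := by decide
    have h20 : perm321 2 < perm321 0 := by decide
    constructor
    · intro i j hij
      fin_cases i <;> fin_cases j <;> simp_all
      exact h1.trans h2
    · intro i j
      fin_cases i <;> fin_cases j <;>
        simp [h10, h21, h01, h02, h12, h20, h3, h4, h3.le, h4.le, h4.trans h3, (h4.trans h3).le]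

theorem isOccurrence_perm123_iff {n : ℕ} (p : Equiv.Perm (Fin n)) (f : Fin 3 → Fin n) :
    IsOccurrence perm123 p f ↔ f 0 < f 1 ∧ f 1 < f 2 ∧ p (f 0) < p (f 1) ∧ p (f 1) < p (f 2) := by
  have h01 : perm123 0 < perm123 1 := by decide
  have h12 : perm123 1 < perm123 2 := by decide
  constructor
  · rintro ⟨h, h'⟩
    exact ⟨h 0 1 (by decide), h 1 2 (by decide), (h' 0 1).1 h01, (h' 1 2).1 h12⟩
  · rintro ⟨h1, h2, h3, h4⟩
    have h10 : ¬ perm123 1 < perm123 0 := by decide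
    have h20 : ¬ perm123 2 < perm123 0 := by decide
    have h21 : ¬ perm123 2 < perm123 1 := by decide
    have h02 : perm123 0 < perm123 2 := by decide
    constructor
    · intro i j hij
      fin_cases i <;> fin_cases j <;> simp_all
      exact h1.trans h2
    · intro i j
      fin_cases i <;> fin_cases j <;>
        simp [h10, h21, h01, h02, h12, h20, h3, h4, h3.le, h4.le, h3.trans h4, (h3.trans h4).le]

/-- `p` has no increasing subsequence of length three. -/
def Avoids123 {n : ℕ} (p : Equiv.Perm (Fin n)) : Prop :=
  ∀ i j k, i < j → j < k → p i < p j → ¬ p j < p k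

instance {n : ℕ} : DecidablePred (Avoids123 (n := n)) := fun p => by
  unfold Avoids123; infer_instance

theorem mem_avoiders_perm123 {n : ℕ} (p : Equiv.Perm (Fin n)) :
    p ∈ avoiders n perm123 ↔ Avoids123 p := by
  simp only [avoiders, ContainsPattern, isOccurrence_perm123_iff, Finset.mem_filter,
    Finset.mem_univ, true_and]
  constructor
  · intro h i j k hij hjk h1 h2
    exact h ⟨![i, j, k], hij, hjk, h1, h2⟩
  · rintro h ⟨f, h1, h2, h3, h4⟩
    exact h _ _ _ h1 h2 h3 h4

/-- Functions on `Fin 3` are triples. -/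
def finThreeArrowEquiv (α : Type*) : (Fin 3 → α) ≃ α × α × α where
  toFun f := (f 0, f 1, f 2)
  invFun x := ![x.1, x.2.1, x.2.2]
  left_inv f := by ext i; fin_cases i <;> rfl
  right_inv _ := rfl

theorem patternCount_perm321 {n : ℕ} (p : Equiv.Perm (Fin n)) :
    (patternCount perm321 p : ℚ) =
      ∑ i, ∑ j, ∑ k, if i < j ∧ j < k ∧ p j < p i ∧ p k < p j then (1 : ℚ) else 0 := by
  rw [patternCount, Finset.card_filter, Nat.cast_sum,
    Fintype.sum_equiv (finThreeArrowEquiv (Fin n)) _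
      (fun x => if x.1 < x.2.1 ∧ x.2.1 < x.2.2 ∧ p x.2.1 < p x.1 ∧ p x.2.2 < p x.2.1
        then (1 : ℚ) else 0)]
  · rw [Fintype.sum_prod_type]
    simp_rw [Fintype.sum_prod_type]
  · intro f
    rw [Nat.cast_ite, Nat.cast_one, Nat.cast_zero]
    exact if_congr (isOccurrence_perm321_iff p f) rfl rfl

/-! ### Counting triples of positions -/

/-- The indicator of `i < j`. -/
def ltInd {n : ℕ} (i j : Fin n) : ℚ := if i < j then 1 else 0

/-- The indicator of a non-inversion of `p` at the positions `i < j`. -/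
def ascInd {n : ℕ} (p : Equiv.Perm (Fin n)) (i j : Fin n) : ℚ :=
  if i < j ∧ p i < p j then 1 else 0

/-- The number of larger entries to the right of position `i`. -/
def rightLarger {n : ℕ} (p : Equiv.Perm (Fin n)) (i : Fin n) : ℕ :=
  (Finset.univ.filter (fun j => i < j ∧ p i < p j)).card

/-- The number of smaller entries to the left of position `j`. -/
def leftSmaller {n : ℕ} (p : Equiv.Perm (Fin n)) (j : Fin n) : ℕ :=
  (Finset.univ.filter (fun i => i < j ∧ p i < p j)).card

theorem sum_ascInd_right {n : ℕ} (p : Equiv.Perm (Fin n)) (i : Fin n) :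
    ∑ j, ascInd p i j = rightLarger p i := by
  simp [ascInd, rightLarger]

theorem sum_ascInd_left {n : ℕ} (p : Equiv.Perm (Fin n)) (j : Fin n) :
    ∑ i, ascInd p i j = leftSmaller p j := by
  simp [ascInd, leftSmaller]

/-- A third position lies right of, between or left of the pair; only the two positions of the pair
are excluded. -/
theorem sum_third_position {n : ℕ} {x y : Fin n} (h : x < y) :
    ∑ z, (ltInd y z + ltInd x z * ltInd z y + ltInd z x) = (n : ℚ) - 2 := by
  have : ∀ z, ltInd y z + ltInd x z * ltInd z y + ltInd z x =
      1 - (if z = x then (1 : ℚ) else 0) - (if z = y then (1 : ℚ) else 0) := by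
    intro z
    unfold ltInd
    rcases lt_trichotomy z x with hx | rfl | hx
    · simp [hx, hx.ne, (hx.trans h).ne, (hx.trans h).not_gt, hx.not_gt]
    · simp [h.ne, h, h.not_gt]
    · rcases lt_trichotomy z y with hy | rfl | hy
      · simp [hx, hx.ne', hy, hy.ne, hx.not_gt, hy.not_gt]
      · simp [hx.ne', hx.not_gt]
      · simp [hx, hx.ne', hy, hy.ne', hx.not_gt, hy.not_gt]
  simp_rw [this]
  simp [Finset.sum_sub_distrib]
  ring

theorem sum_triples_pairs {n : ℕ} (w : Fin n → Fin n → ℚ) (hw : ∀ i j, ¬ i < j → w i j = 0) :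
    ∑ i, ∑ j, ∑ k, ltInd i j * ltInd j k * (w i j + w i k + w j k) =
      ((n : ℚ) - 2) * ∑ i, ∑ j, w i j := by
  have hl : ∀ i j, ltInd i j * w i j = w i j := by
    intro i j
    by_cases h : i < j
    · simp [ltInd, h]
    · simp [hw i j h]
  have h1 : ∑ x, ∑ y, w x y * ∑ z, (ltInd y z + ltInd x z * ltInd z y + ltInd z x) =
      ((n : ℚ) - 2) * ∑ i, ∑ j, w i j := by
    rw [Finset.mul_sum]
    refine Finset.sum_congr rfl fun x _ => ?_
    rw [Finset.mul_sum]
    refine Finset.sum_congr rfl fun y _ => ?_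
    by_cases h : x < y
    · rw [sum_third_position h]; ring
    · simp [hw x y h]
  rw [← h1]
  have e1 : ∑ i, ∑ j, ∑ k, ltInd i j * ltInd j k * w i j =
      ∑ x, ∑ y, ∑ z, w x y * ltInd y z := by
    refine Finset.sum_congr rfl fun x _ => Finset.sum_congr rfl fun y _ =>
      Finset.sum_congr rfl fun z _ => ?_
    linear_combination ltInd y z * hl x y
  have e2 : ∑ i, ∑ j, ∑ k, ltInd i j * ltInd j k * w i k =
      ∑ x, ∑ y, ∑ z, w x y * (ltInd x z * ltInd z y) := by
    refine Finset.sum_congr rfl fun x _ => ?_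
    rw [Finset.sum_comm]
    refine Finset.sum_congr rfl fun y _ => Finset.sum_congr rfl fun z _ => ?_
    ring
  have e3 : ∑ i, ∑ j, ∑ k, ltInd i j * ltInd j k * w j k =
      ∑ x, ∑ y, ∑ z, w x y * ltInd z x := by
    rw [Finset.sum_comm]
    refine Finset.sum_congr rfl fun x _ => ?_
    rw [Finset.sum_comm]
    refine Finset.sum_congr rfl fun y _ => Finset.sum_congr rfl fun z _ => ?_
    linear_combination ltInd z x * hl x y
  simp_rw [mul_add, Finset.sum_add_distrib]
  rw [e1, e2, e3]
  simp_rw [mul_add, Finset.mul_sum, Finset.sum_add_distrib]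

theorem sum_pairs (n : ℕ) : 2 * ∑ i : Fin n, ∑ j, ltInd i j = (n : ℚ) * (n - 1) := by
  have h : ∀ i j : Fin n, ltInd i j + ltInd j i = 1 - if j = i then (1 : ℚ) else 0 := by
    intro i j
    unfold ltInd
    rcases lt_trichotomy i j with h | rfl | h
    · simp [h, h.ne', h.not_gt]
    · simp
    · simp [h, h.ne, h.not_gt]
  have h2 : ∑ i : Fin n, ∑ j, ltInd i j + ∑ i : Fin n, ∑ j, ltInd j i = (n : ℚ) * (n - 1) := by
    simp_rw [← Finset.sum_add_distrib, h]
    simp [Finset.sum_sub_distrib]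
    ring
  rw [Finset.sum_comm (f := fun i j : Fin n => ltInd j i)] at h2
  linarith

theorem sum_triples (n : ℕ) :
    6 * ∑ i : Fin n, ∑ j, ∑ k, ltInd i j * ltInd j k = (n : ℚ) * (n - 1) * (n - 2) := by
  -- Taking the weight 1 on each pair counts every triple three times.
  have h := sum_triples_pairs (n := n) ltInd (fun i j h => by simp [ltInd, h])
  have h3 : ∀ i j k : Fin n, ltInd i j * ltInd j k * (ltInd i j + ltInd i k + ltInd j k) =
      3 * (ltInd i j * ltInd j k) := by
    intro i j k
    by_cases h1 : i < j
    · by_cases h2 : j < k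
      · simp [ltInd, h1, h2, h1.trans h2]; norm_num
      · simp [ltInd, h2]
    · simp [ltInd, h1]
  simp_rw [h3, ← Finset.mul_sum] at h
  simp_rw [← Finset.mul_sum]
  linear_combination 2 * h + ((n : ℚ) - 2) * sum_pairs n

theorem sum_sq_eq_of_indicator {n : ℕ} (f : Fin n → ℚ) (hf : ∀ i, f i * f i = f i) :
    (∑ i, f i) ^ 2 = 2 * ∑ i, ∑ j, ltInd i j * (f i * f j) + ∑ i, f i := by
  have h : ∀ i j : Fin n, f i * f j =
      ltInd i j * (f i * f j) + ltInd j i * (f j * f i) + if j = i then f i else 0 := by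
    intro i j
    unfold ltInd
    rcases lt_trichotomy i j with h | rfl | h
    · simp [h, h.ne', h.not_gt]
    · simp [hf]
    · simp [h, h.ne, h.not_gt, mul_comm]
  rw [sq, Finset.sum_mul_sum]
  rw [Finset.sum_congr rfl fun i _ => Finset.sum_congr rfl fun j _ => h i j]
  simp_rw [Finset.sum_add_distrib]
  rw [Finset.sum_comm (f := fun i j : Fin n => ltInd j i * (f j * f i))]
  simp
  ring

theorem ascInd_sq {n : ℕ} (p : Equiv.Perm (Fin n)) (i j : Fin n) :
    ascInd p i j * ascInd p i j = ascInd p i j := by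
  unfold ascInd; split_ifs <;> simp

/-- In the expansion over triples, ab counts pairs of larger entries right of i and bc counts pairs
of smaller entries left of k. Each is half of a square minus a linear term; since Σl = Σr, the
linear terms turn the factor n - 2 into n - 1. -/
theorem patternCount_perm321_of_avoids {n : ℕ} {p : Equiv.Perm (Fin n)} (hp : Avoids123 p) :
    6 * (patternCount perm321 p : ℚ) = n * (n - 1) * (n - 2)
      - 6 * (n - 1) * ∑ i, (rightLarger p i : ℚ)
      + 3 * ∑ i, (rightLarger p i : ℚ) ^ 2 + 3 * ∑ i, (leftSmaller p i : ℚ) ^ 2 := by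
  have hpt : ∀ i j k : Fin n, (if i < j ∧ j < k ∧ p j < p i ∧ p k < p j then (1 : ℚ) else 0) =
      ltInd i j * ltInd j k - ltInd i j * ltInd j k * (ascInd p i j + ascInd p i k + ascInd p j k)
        + ltInd j k * (ascInd p i j * ascInd p i k)
        + ltInd i j * (ascInd p i k * ascInd p j k) := by
    intro i j k
    by_cases hij : i < j
    · by_cases hjk : j < k
      · have hav := hp i j k hij hjk
        have n1 : p i ≠ p j := fun h => hij.ne (p.injective h)
        have n2 : p j ≠ p k := fun h => hjk.ne (p.injective h)
        have n3 : p i ≠ p k := fun h => (hij.trans hjk).ne (p.injective h)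
        simp only [ltInd, ascInd, hij, hjk, hij.trans hjk, true_and, if_true]
        by_cases a : p i < p j <;> by_cases b : p i < p k <;> by_cases c : p j < p k <;>
          simp [a, b, c] <;> grind
      · simp [ltInd, ascInd, hjk]
    · simp [ltInd, ascInd, hij]
  have hr : ∑ i, (rightLarger p i : ℚ) ^ 2 =
      2 * ∑ i, ∑ j, ∑ k, ltInd j k * (ascInd p i j * ascInd p i k)
        + ∑ i, (rightLarger p i : ℚ) := by
    rw [Finset.mul_sum, ← Finset.sum_add_distrib]
    refine Finset.sum_congr rfl fun i _ => ?_
    rw [← sum_ascInd_right, sum_sq_eq_of_indicator _ (ascInd_sq p i)]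
  have hlr : ∑ i, (leftSmaller p i : ℚ) = ∑ i, (rightLarger p i : ℚ) := by
    simp_rw [← sum_ascInd_right, ← sum_ascInd_left]
    exact Finset.sum_comm
  have hl : ∑ i, (leftSmaller p i : ℚ) ^ 2 =
      2 * ∑ i, ∑ j, ∑ k, ltInd i j * (ascInd p i k * ascInd p j k)
        + ∑ i, (rightLarger p i : ℚ) := by
    have : ∑ i, ∑ j, ∑ k, ltInd i j * (ascInd p i k * ascInd p j k) =
        ∑ k, ∑ i, ∑ j, ltInd i j * (ascInd p i k * ascInd p j k) := by
      rw [Finset.sum_comm' (t' := Finset.univ) (s' := fun _ => Finset.univ) (by simp)]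
      rw [Finset.sum_congr rfl fun j _ => Finset.sum_comm, Finset.sum_comm]
      exact Finset.sum_congr rfl fun k _ => Finset.sum_comm
    rw [this, ← hlr, Finset.mul_sum, ← Finset.sum_add_distrib]
    refine Finset.sum_congr rfl fun k _ => ?_
    rw [← sum_ascInd_left, sum_sq_eq_of_indicator _ fun i => ascInd_sq p i k]
  have hpairs := sum_triples_pairs (ascInd p) (fun i j h => by simp [ascInd, h])
  simp_rw [sum_ascInd_right] at hpairs
  rw [patternCount_perm321]
  simp_rw [hpt, Finset.sum_add_distrib, Finset.sum_sub_distrib]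
  rw [hpairs]
  linear_combination sum_triples n - 3 * hr - 3 * hl

/-! ### Prepending an entry -/

/-- The permutation with first entry `v` whose other entries are in the relative order of `p`. -/
def prependEntry {n : ℕ} (v : Fin (n + 1)) (p : Equiv.Perm (Fin n)) : Equiv.Perm (Fin (n + 1)) :=
  ((finSuccEquiv' 0).trans p.optionCongr).trans (finSuccEquiv' v).symm

@[simp]
theorem prependEntry_zero {n : ℕ} (v : Fin (n + 1)) (p : Equiv.Perm (Fin n)) :
    prependEntry v p 0 = v := by
  simp [prependEntry]

@[simp]
theorem prependEntry_succ {n : ℕ} (v : Fin (n + 1)) (p : Equiv.Perm (Fin n)) (i : Fin n) :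
    prependEntry v p i.succ = v.succAbove (p i) := by
  have : (finSuccEquiv' (0 : Fin (n + 1))) i.succ = some i := by
    rw [← Fin.succAbove_zero, finSuccEquiv'_succAbove]
  simp [prependEntry, this]

theorem prependEntry_bijective (n : ℕ) :
    Function.Bijective
      (fun x : Fin (n + 1) × Equiv.Perm (Fin n) => prependEntry x.1 x.2) := by
  rw [Fintype.bijective_iff_injective_and_card]
  constructor
  · rintro ⟨v, p⟩ ⟨w, q⟩ h
    have hv : v = w := by simpa using congrArg (fun e => e 0) h
    subst hv
    congr 1
    ext i
    have := congrArg (fun e => e i.succ) h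
    simp only [prependEntry_succ] at this
    rw [Fin.succAbove_right_injective this]
  · simp [Fintype.card_perm, Nat.factorial_succ]

theorem lt_succAbove_iff_val {n : ℕ} (v : Fin (n + 1)) (x : Fin n) :
    v < v.succAbove x ↔ (v : ℕ) ≤ x := by
  rw [Fin.lt_succAbove_iff_le_castSucc, Fin.le_def, Fin.val_castSucc]

/-- One more than the largest entry of `p` that has a larger entry to its right, or `0` if there is
no such entry. -/
def ascentBound {n : ℕ} (p : Equiv.Perm (Fin n)) : ℕ :=
  Finset.univ.sup (fun x : Fin n × Fin n => if x.1 < x.2 ∧ p x.1 < p x.2 then (p x.1 : ℕ) + 1 else 0)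

theorem ascentBound_le_iff {n : ℕ} (p : Equiv.Perm (Fin n)) (b : ℕ) :
    ascentBound p ≤ b ↔ ∀ i j, i < j → p i < p j → (p i : ℕ) < b := by
  simp only [ascentBound, Finset.sup_le_iff, Finset.mem_univ, true_implies, Prod.forall]
  refine forall_congr' fun i => forall_congr' fun j => ?_
  split_ifs with h
  · simp [h]
  · simp only [zero_le, true_iff]
    exact fun h1 h2 => absurd ⟨h1, h2⟩ h

theorem ascentBound_le {n : ℕ} (p : Equiv.Perm (Fin n)) : ascentBound p ≤ n :=
  (ascentBound_le_iff p n).2 fun i _ _ _ => (p i).2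

/-- A new 123 must start at the new entry, followed by an ascent whose lower value is at least v
before relabelling. -/
theorem avoids123_prependEntry_iff {n : ℕ} (v : Fin (n + 1)) (p : Equiv.Perm (Fin n)) :
    Avoids123 (prependEntry v p) ↔ Avoids123 p ∧ ascentBound p ≤ v := by
  rw [ascentBound_le_iff]
  constructor
  · intro h
    constructor
    · intro i j k hij hjk h1 h2
      exact h i.succ j.succ k.succ (by simpa) (by simpa) (by simpa) (by simpa)
    · intro i j hij h1
      by_contra hc
      refine h 0 i.succ j.succ (Fin.succ_pos i) (by simpa) ?_ (by simpa)
      simpa [lt_succAbove_iff_val] using hc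
  · rintro ⟨h, hb⟩ i j k hij hjk
    obtain ⟨k, rfl⟩ := Fin.exists_succ_eq.2 (Fin.ne_zero_of_lt hjk)
    obtain ⟨j, rfl⟩ := Fin.exists_succ_eq.2 (Fin.ne_zero_of_lt hij)
    simp only [Fin.succ_lt_succ_iff] at hjk
    refine Fin.cases ?_ (fun i => ?_) i hij
    · intro _ h1 h2
      simp only [prependEntry_zero, prependEntry_succ, lt_succAbove_iff_val,
        Fin.succAbove_lt_succAbove_iff] at h1 h2
      exact absurd (hb j k hjk h2) (not_lt.2 h1)
    · intro hij h1 h2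
      simp only [prependEntry_succ, Fin.succAbove_lt_succAbove_iff, Fin.succ_lt_succ_iff]
        at hij h1 h2
      exact h i j k hij hjk h1 h2

/-- A maximal first entry starts no ascent and shifts no value. -/
theorem ascentBound_prependEntry_last {n : ℕ} (p : Equiv.Perm (Fin n)) :
    ascentBound (prependEntry (Fin.last n) p) = ascentBound p := by
  refine eq_of_forall_ge_iff fun b => ?_
  rw [ascentBound_le_iff, ascentBound_le_iff]
  constructor
  · intro h i j hij h1
    simpa using h i.succ j.succ (by simpa) (by simpa)
  · intro h i j hij
    obtain ⟨j, rfl⟩ := Fin.exists_succ_eq.2 (Fin.ne_zero_of_lt hij)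
    refine Fin.cases ?_ (fun i => ?_) i hij
    · intro _ h1
      exact absurd h1 (by simp [Fin.le_last])
    · intro hij h1
      simp only [prependEntry_succ, Fin.succAbove_last, Fin.castSucc_lt_castSucc_iff,
        Fin.succ_lt_succ_iff] at hij h1
      simpa using h i j hij h1

/-- The new entry v becomes the largest lower end of an ascent: the old ones lie below v and are not
shifted. -/
theorem ascentBound_prependEntry_castSucc {n : ℕ} (v : Fin n) (p : Equiv.Perm (Fin n))
    (hv : ascentBound p ≤ v) : ascentBound (prependEntry v.castSucc p) = v + 1 := by
  refine eq_of_forall_ge_iff fun b => ?_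
  rw [ascentBound_le_iff] at hv ⊢
  constructor
  · intro h
    -- The old entry of value v is shifted to v + 1, so it forms an ascent with the new first entry.
    have := h 0 (p.symm v).succ (Fin.succ_pos _) (by simp)
    simpa using this
  · intro h i j hij
    obtain ⟨j, rfl⟩ := Fin.exists_succ_eq.2 (Fin.ne_zero_of_lt hij)
    refine Fin.cases ?_ (fun i => ?_) i hij
    · intro _ _
      simpa using h
    · intro hij h1
      simp only [prependEntry_succ, Fin.succAbove_lt_succAbove_iff, Fin.succ_lt_succ_iff]
        at hij h1
      have h2 := hv i j hij h1
      rw [prependEntry_succ, Fin.succAbove_of_castSucc_lt _ _ (by simpa using h2)]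
      simp only [Fin.val_castSucc]
      omega

theorem rightLarger_prependEntry_succ {n : ℕ} (v : Fin (n + 1)) (p : Equiv.Perm (Fin n))
    (i : Fin n) : rightLarger (prependEntry v p) i.succ = rightLarger p i := by
  simp only [rightLarger, Finset.card_filter, Fin.sum_univ_succ, prependEntry_succ,
    Fin.succAbove_lt_succAbove_iff, Fin.succ_lt_succ_iff, Fin.not_lt_zero, false_and, if_false,
    zero_add]

theorem rightLarger_prependEntry_zero {n : ℕ} (v : Fin (n + 1)) (p : Equiv.Perm (Fin n)) :
    rightLarger (prependEntry v p) 0 = n - v := by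
  simp only [rightLarger, Finset.card_filter, Fin.sum_univ_succ, prependEntry_succ,
    prependEntry_zero, lt_irrefl, and_self, if_false, zero_add, Fin.succ_pos, true_and,
    lt_succAbove_iff_val]
  rw [Equiv.sum_comp p (fun x : Fin n => if (v : ℕ) ≤ x then 1 else 0),
    Fin.sum_univ_eq_sum_range (fun x => if (v : ℕ) ≤ x then 1 else 0) n, ← Finset.card_filter]
  have : (Finset.range n).filter (fun x => (v : ℕ) ≤ x) = Finset.Ico (v : ℕ) n := by
    ext x; simp [and_comm]
  rw [this, Nat.card_Ico]

/-- The sum of `g` over the numbers of larger entries to the right of each entry. -/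
def codeSum (g : ℕ → ℚ) {n : ℕ} (p : Equiv.Perm (Fin n)) : ℚ := ∑ i, g (rightLarger p i)

theorem codeSum_prependEntry (g : ℕ → ℚ) {n : ℕ} (v : Fin (n + 1)) (p : Equiv.Perm (Fin n)) :
    codeSum g (prependEntry v p) = g (n - v) + codeSum g p := by
  simp only [codeSum, Fin.sum_univ_succ, rightLarger_prependEntry_zero,
    rightLarger_prependEntry_succ]

theorem sum_fin_ge_sub {n b : ℕ} (hb : b ≤ n) (F : ℕ → ℚ) :
    ∑ v : Fin n, (if b ≤ (v : ℕ) then F (n - v) else 0) =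
      ∑ r ∈ Finset.range (n - b), F (r + 1) := by
  rw [Fin.sum_univ_eq_sum_range (fun v => if b ≤ v then F (n - v) else 0) n,
    ← Finset.sum_range_reflect, ← Finset.sum_filter]
  have : (Finset.range n).filter (fun j => b ≤ n - 1 - j) = Finset.range (n - b) := by
    ext j; simp only [Finset.mem_filter, Finset.mem_range]; omega
  rw [this]
  refine Finset.sum_congr rfl fun r hr => ?_
  rw [Finset.mem_range] at hr
  congr 1
  omega

/-- The sum over the `123`-avoiders of length `n + 1`, organised by the avoider that remains when
the first entry is deleted. -/
theorem sum_avoids123_succ (g : ℕ → ℚ) (hg : g 0 = 0) (G : ℕ → ℚ → ℚ) (n : ℕ) :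
    ∑ p : Equiv.Perm (Fin (n + 1)),
        (if Avoids123 p then G (n + 1 - ascentBound p) (codeSum g p) else 0) =
      ∑ p : Equiv.Perm (Fin n), if Avoids123 p then
        (G (n - ascentBound p + 1) (codeSum g p) + ∑ r ∈ Finset.range (n - ascentBound p),
          G (r + 1) (g (r + 1) + codeSum g p)) else 0 := by
  rw [← Equiv.sum_comp (Equiv.ofBijective _ (prependEntry_bijective n)), Fintype.sum_prod_type,
    Finset.sum_comm]
  refine Finset.sum_congr rfl fun p _ => ?_
  simp only [Equiv.ofBijective_apply, avoids123_prependEntry_iff, codeSum_prependEntry]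
  by_cases hp : Avoids123 p
  · simp only [hp, true_and, if_true]
    rw [Fin.sum_univ_castSucc, ascentBound_prependEntry_last, add_comm]
    have hb := ascentBound_le p
    congr 1
    -- A maximal first entry has no larger entry to its right and contributes `g 0 = 0`.
    · simp only [Fin.val_last, hb, if_true, Nat.sub_self, hg, zero_add]
      congr 1
      omega
    · rw [← sum_fin_ge_sub hb (fun r => G r (g r + codeSum g p))]
      refine Finset.sum_congr rfl fun v _ => ?_
      simp only [Fin.val_castSucc]
      split_ifs with h
      -- The new label is n + 1 - (v + 1) = n - v, which is also the code of the new entry.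
      · rw [ascentBound_prependEntry_castSucc v p h]
        congr 1
        omega
      · rfl
  · simp [hp]

/-! ### A generating tree and its generating functions -/

/-- The number of paths of length `n` from the label `k` in the generating tree in which the
children of `k` are labelled `k + 1` and `1, …, k`. -/
def treeCount : ℕ → ℕ → ℚ
  | 0, _ => 1
  | n + 1, k => treeCount n (k + 1) + ∑ r ∈ Finset.range k, treeCount n (r + 1)

/-- The total weight of the paths of length `n` from the label `k`, where a step from `k` to
`r ∈ {1, …, k}` weighs `g r` and a step to `k + 1` weighs nothing. -/
def treeWeight (g : ℕ → ℚ) : ℕ → ℕ → ℚ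
  | 0, _ => 0
  | n + 1, k => treeWeight g n (k + 1) +
      ∑ r ∈ Finset.range k, (treeWeight g n (r + 1) + g (r + 1) * treeCount n (r + 1))

open PowerSeries

/-- The hypotheses are the tree recursion after subtracting consecutive labels, which removes the
sum over children; telescoping restores it. -/
theorem coeff_eq_treeCount (A : ℕ → ℚ⟦X⟧) (h0 : A 0 = 1 + X * A 1)
    (hs : ∀ k, A (k + 1) = A k + X * A (k + 2)) (n k : ℕ) :
    coeff n (A k) = treeCount n k := by
  have h : ∀ k, A k = 1 + X * (A (k + 1) + ∑ r ∈ Finset.range k, A (r + 1)) := by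
    intro k
    induction k with
    | zero => simp [← h0]
    | succ k ih =>
      rw [Finset.sum_range_succ]
      linear_combination ih + hs k
  induction n generalizing k with
  | zero => rw [h k]; simp [treeCount]
  | succ n ih =>
    rw [h k, map_add, coeff_succ_X_mul, coeff_one]
    simp [treeCount, ih]

theorem coeff_eq_treeWeight (g : ℕ → ℚ) (A B : ℕ → ℚ⟦X⟧)
    (hA : ∀ n k, coeff n (A k) = treeCount n k) (h0 : B 0 = X * B 1)
    (hs : ∀ k, B (k + 1) = B k + X * (B (k + 2) + C (g (k + 1)) * A (k + 1))) (n k : ℕ) :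
    coeff n (B k) = treeWeight g n k := by
  have h : ∀ k, B k = X * (B (k + 1) +
      ∑ r ∈ Finset.range k, (B (r + 1) + C (g (r + 1)) * A (r + 1))) := by
    intro k
    induction k with
    | zero => simp [← h0]
    | succ k ih =>
      rw [Finset.sum_range_succ]
      linear_combination ih + hs k
  induction n generalizing k with
  | zero => rw [h k]; simp [treeWeight]
  | succ n ih =>
    rw [h k, coeff_succ_X_mul]
    simp [treeWeight, ih, hA]

/-- The series `1 / √(1 - 4x)`. -/
noncomputable def invSqrt : ℚ⟦X⟧ := sqrtOneSubFourX⁻¹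

/-- The Catalan series `2 / (1 + √(1 - 4x))`. -/
noncomputable def catalanGF : ℚ⟦X⟧ := 2 * (1 + sqrtOneSubFourX)⁻¹

theorem sqrt_mul_invSqrt : sqrtOneSubFourX * invSqrt = 1 :=
  PowerSeries.mul_inv_cancel _ (by rw [constantCoeff_sqrtOneSubFourX]; norm_num)

theorem catalanGF_mul : catalanGF * (1 + sqrtOneSubFourX) = 2 := by
  rw [catalanGF, mul_assoc, PowerSeries.inv_mul_cancel _
    (by rw [map_add, constantCoeff_sqrtOneSubFourX]; norm_num), mul_one]

theorem two_ne_zero_series : (2 : ℚ⟦X⟧) ≠ 0 := by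
  intro h
  have := congrArg constantCoeff h
  rw [map_ofNat, map_zero] at this
  norm_num at this

theorem two_X_mul_catalanGF : 2 * (X * catalanGF) = 1 - sqrtOneSubFourX := by
  apply mul_left_cancel₀ two_ne_zero_series
  linear_combination (1 - sqrtOneSubFourX) * catalanGF_mul + catalanGF * sqrtOneSubFourX_sq

theorem catalanGF_eq : catalanGF = 1 + X * catalanGF ^ 2 := by
  apply mul_left_cancel₀ two_ne_zero_series
  linear_combination catalanGF_mul - catalanGF * two_X_mul_catalanGF

theorem coeff_catalanGF_pow (n k : ℕ) :
    coeff n (catalanGF ^ (k + 1)) = treeCount n k := by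
  refine coeff_eq_treeCount (fun k => catalanGF ^ (k + 1)) ?_ ?_ n k
  · simpa using catalanGF_eq
  · intro k
    linear_combination catalanGF ^ (k + 1) * catalanGF_eq

/-- Substituting x C^(k+1) P_k into the differenced recursion and using xC² = C - 1 and C(1 + s) =
2, with s = √(1-4x), cancels the powers of C and leaves a linear recurrence for P_k alone. -/
theorem coeff_eq_treeWeight_of_factor (g : ℕ → ℚ) (P : ℕ → ℚ⟦X⟧)
    (h0 : 2 * P 0 = (1 - sqrtOneSubFourX) * P 1)
    (hs : ∀ k, 2 * (P (k + 1) - P (k + 2) - C (g (k + 1))) =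
      (1 + sqrtOneSubFourX) * (P k - P (k + 2))) (n : ℕ) :
    coeff n (X * catalanGF * P 0) = treeWeight g n 0 := by
  have h := coeff_eq_treeWeight g (fun k => catalanGF ^ (k + 1))
    (fun k => X * catalanGF ^ (k + 1) * P k) coeff_catalanGF_pow ?_ ?_ n 0
  · simpa using h
  · apply mul_left_cancel₀ two_ne_zero_series
    linear_combination X * catalanGF * h0 - X * catalanGF * P 1 * two_X_mul_catalanGF
  · intro k
    apply mul_left_cancel₀ two_ne_zero_series
    linear_combination X * catalanGF ^ (k + 2) * hs k +
      X * catalanGF ^ (k + 1) * (P k - P (k + 2)) * catalanGF_mul +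
      2 * X * catalanGF ^ (k + 1) * P (k + 2) * catalanGF_eq

/-- The recurrence has a solution polynomial in k, of degree one more than the weight. Its constant
term is fixed by the condition at k = 0. The factor 2 in the weight avoids fractions. -/
theorem coeff_treeWeight_linear (n : ℕ) :
    coeff n (X * catalanGF * (invSqrt ^ 2 - invSqrt)) =
      treeWeight (fun r => 2 * (r : ℚ)) n 0 := by
  have h := coeff_eq_treeWeight_of_factor (fun r => 2 * (r : ℚ))
    (fun k => invSqrt * ((k : ℚ⟦X⟧) ^ 2 - 1) + invSqrt ^ 2 * ((k : ℚ⟦X⟧) + 1)) ?_ ?_ n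
  · rw [← h]
    congr 1
    push_cast
    ring
  · push_cast
    linear_combination 2 * invSqrt * sqrt_mul_invSqrt
  · intro k
    simp only [map_mul, map_natCast, map_ofNat]
    push_cast
    linear_combination (2 * invSqrt + 4 * (k + 1)) * sqrt_mul_invSqrt

theorem coeff_treeWeight_quadratic (n : ℕ) :
    coeff n (X * catalanGF * (3 * invSqrt ^ 3 - 3 * invSqrt ^ 2)) =
      treeWeight (fun r => 6 * (r : ℚ) ^ 2) n 0 := by
  have h := coeff_eq_treeWeight_of_factor (fun r => 6 * (r : ℚ) ^ 2)
    (fun k => 2 * invSqrt * (k : ℚ⟦X⟧) ^ 3 + 3 * invSqrt ^ 2 * (k : ℚ⟦X⟧) ^ 2 +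
      (3 * invSqrt ^ 3 - 2 * invSqrt) * k + 3 * invSqrt ^ 3 - 3 * invSqrt ^ 2) ?_ ?_ n
  · rw [← h]
    congr 1
    push_cast
    ring
  · push_cast
    linear_combination 6 * invSqrt ^ 2 * sqrt_mul_invSqrt
  · intro k
    simp only [map_mul, map_pow, map_natCast, map_ofNat]
    push_cast
    linear_combination (12 * ((k : ℚ⟦X⟧) + 1) ^ 2 + 12 * invSqrt * (k + 1) + 6 * invSqrt ^ 2) *
      sqrt_mul_invSqrt

/-! ### Sums over the `123`-avoiders -/

/-- Splitting a path of length n + m from the root after n steps: the first part is an avoider, the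
second a path from its label. The extra parameter m makes induction on n possible. -/
theorem sum_avoids123_treeCount (n m : ℕ) :
    ∑ p : Equiv.Perm (Fin n), (if Avoids123 p then treeCount m (n - ascentBound p) else 0) =
      treeCount (n + m) 0 := by
  induction n generalizing m with
  | zero => simp [Avoids123]
  | succ n ih =>
    rw [sum_avoids123_succ (fun _ => 0) rfl (fun k _ => treeCount m k), add_right_comm, add_assoc,
      ← ih]
    rfl

/-- The weight of a split path is the weight still to come plus the weight `codeSum g p` already
collected, the latter once for each continuation. -/
theorem sum_avoids123_treeWeight (g : ℕ → ℚ) (hg : g 0 = 0) (n m : ℕ) :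
    ∑ p : Equiv.Perm (Fin n), (if Avoids123 p then treeWeight g m (n - ascentBound p)
        + codeSum g p * treeCount m (n - ascentBound p) else 0) =
      treeWeight g (n + m) 0 := by
  induction n generalizing m with
  | zero => simp [Avoids123, codeSum]
  | succ n ih =>
    rw [sum_avoids123_succ g hg (fun k s => treeWeight g m k + s * treeCount m k), add_right_comm,
      add_assoc, ← ih]
    refine Finset.sum_congr rfl fun p _ => if_congr Iff.rfl ?_ rfl
    simp only [treeWeight, treeCount, mul_add, add_mul, Finset.mul_sum, Finset.sum_add_distrib]
    ring

theorem card_avoiders_perm123 (n : ℕ) : ((avoiders n perm123).card : ℚ) = treeCount n 0 := by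
  have h := sum_avoids123_treeCount n 0
  simp only [treeCount, add_zero] at h
  rw [← h, Finset.card_eq_sum_ones, Nat.cast_sum, ← Finset.sum_filter]
  refine Finset.sum_congr ?_ fun _ _ => by simp
  ext p
  simp [mem_avoiders_perm123]

theorem sum_avoiders_codeSum (g : ℕ → ℚ) (hg : g 0 = 0) (n : ℕ) :
    ∑ p ∈ avoiders n perm123, codeSum g p = treeWeight g n 0 := by
  have h := sum_avoids123_treeWeight g hg n 0
  simp only [treeCount, treeWeight, add_zero, zero_add, mul_one] at h
  rw [← h, ← Finset.sum_filter]
  refine Finset.sum_congr ?_ fun _ _ => rfl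
  ext p
  simp [mem_avoiders_perm123]

/-! ### Reverse complement -/

theorem avoids123_permCongr_rev {n : ℕ} {p : Equiv.Perm (Fin n)} (hp : Avoids123 p) :
    Avoids123 (Fin.revPerm.permCongr p) := by
  intro i j k hij hjk h1 h2
  simp only [Equiv.permCongr_apply, Fin.revPerm_symm, Fin.revPerm_apply, Fin.rev_lt_rev] at h1 h2
  exact hp k.rev j.rev i.rev (by simpa) (by simpa) h2 h1

/-- Conjugation by the reversal flips both positions and values, so ascents remain ascents with
their ends exchanged. -/
theorem leftSmaller_permCongr_rev {n : ℕ} (p : Equiv.Perm (Fin n)) (i : Fin n) :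
    leftSmaller (Fin.revPerm.permCongr p) i.rev = rightLarger p i := by
  simp only [leftSmaller, rightLarger, Finset.card_filter]
  rw [← Equiv.sum_comp Fin.revPerm]
  simp

theorem sum_avoiders_leftSmaller_sq (n : ℕ) :
    ∑ p ∈ avoiders n perm123, ∑ i, (leftSmaller p i : ℚ) ^ 2 =
      ∑ p ∈ avoiders n perm123, ∑ i, (rightLarger p i : ℚ) ^ 2 := by
  have hinv : ∀ p : Equiv.Perm (Fin n), Fin.revPerm.permCongr (Fin.revPerm.permCongr p) = p := by
    intro p; ext i; simp
  symm
  refine Finset.sum_nbij' (fun p => Fin.revPerm.permCongr p) (fun p => Fin.revPerm.permCongr p)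
    ?_ ?_ (fun p _ => hinv p) (fun p _ => hinv p) ?_
  · exact fun p hp => (mem_avoiders_perm123 _).2
      (avoids123_permCongr_rev ((mem_avoiders_perm123 p).1 hp))
  · exact fun p hp => (mem_avoiders_perm123 _).2
      (avoids123_permCongr_rev ((mem_avoiders_perm123 p).1 hp))
  · intro p _
    rw [← Equiv.sum_comp Fin.revPerm (fun i => (leftSmaller _ i : ℚ) ^ 2)]
    simp only [Fin.revPerm_apply, leftSmaller_permCongr_rev]

theorem six_mul_totalPatternCount (n : ℕ) :
    6 * (totalPatternCount perm321 (avoiders n perm123) : ℚ) =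
      n * (n - 1) * (n - 2) * treeCount n 0
        - 3 * (n - 1) * treeWeight (fun r => 2 * (r : ℚ)) n 0
        + treeWeight (fun r => 6 * (r : ℚ) ^ 2) n 0 := by
  rw [← card_avoiders_perm123, ← sum_avoiders_codeSum _ (by simp),
    ← sum_avoiders_codeSum _ (by simp), totalPatternCount, Nat.cast_sum, Finset.mul_sum,
    Finset.sum_congr rfl fun p hp =>
      patternCount_perm321_of_avoids ((mem_avoiders_perm123 p).1 hp)]
  simp only [Finset.sum_add_distrib, Finset.sum_sub_distrib, ← Finset.mul_sum, codeSum,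
    Finset.sum_const, nsmul_eq_mul, sum_avoiders_leftSmaller_sq]
  ring

/-! ### The generating function -/

theorem coeff_X_mul_derivative (f : ℚ⟦X⟧) (n : ℕ) :
    coeff n (X * d⁄dX ℚ f) = n * coeff n f := by
  cases n with
  | zero => simp
  | succ n => rw [coeff_succ_X_mul, coeff_derivative]; push_cast; ring

theorem coeff_X_pow_three_mul_derivative (f : ℚ⟦X⟧) (n : ℕ) :
    coeff n (X ^ 3 * d⁄dX ℚ (d⁄dX ℚ (d⁄dX ℚ f))) = n * (n - 1) * (n - 2) * coeff n f := by
  have h2 : X ^ 2 * d⁄dX ℚ (d⁄dX ℚ f) = X * d⁄dX ℚ (X * d⁄dX ℚ f) - X * d⁄dX ℚ f := by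
    simp only [Derivation.leibniz, derivative_X, smul_eq_mul]; ring
  have h3 : X ^ 3 * d⁄dX ℚ (d⁄dX ℚ (d⁄dX ℚ f)) =
      X * d⁄dX ℚ (X ^ 2 * d⁄dX ℚ (d⁄dX ℚ f)) - C 2 * (X ^ 2 * d⁄dX ℚ (d⁄dX ℚ f)) := by
    simp only [sq, Derivation.leibniz, derivative_X, smul_eq_mul, map_ofNat]; ring
  rw [h3, map_sub, coeff_C_mul, coeff_X_mul_derivative, h2, map_sub, coeff_X_mul_derivative,
    coeff_X_mul_derivative]
  ring

theorem derivative_sqrt : d⁄dX ℚ sqrtOneSubFourX = -2 * invSqrt := by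
  have h := congrArg (d⁄dX ℚ) sqrtOneSubFourX_sq
  have h4 : d⁄dX ℚ (4 : ℚ⟦X⟧) = 0 := by
    rw [← map_ofNat (C (R := ℚ)) 4, derivative_C]
  simp only [sq, map_sub, derivative_one, Derivation.leibniz, derivative_X, smul_eq_mul, h4] at h
  apply mul_left_cancel₀ two_ne_zero_series
  linear_combination invSqrt * h - 2 * d⁄dX ℚ sqrtOneSubFourX * sqrt_mul_invSqrt

theorem derivative_invSqrt : d⁄dX ℚ invSqrt = 2 * invSqrt ^ 3 := by
  rw [invSqrt, derivative_inv', derivative_sqrt, invSqrt]; ring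

theorem derivative_X_mul_catalanGF : d⁄dX ℚ (X * catalanGF) = invSqrt := by
  have h := congrArg (d⁄dX ℚ) two_X_mul_catalanGF
  rw [two_mul, map_add, map_sub, derivative_sqrt, derivative_one] at h
  apply mul_left_cancel₀ two_ne_zero_series
  linear_combination h

/-- With T = 1/√(1-4x), the rules C' = C²T and T' = 2T³ keep all derivatives polynomial in C and T.
-/
theorem derivative_catalanGF : d⁄dX ℚ catalanGF = catalanGF ^ 2 * invSqrt := by
  have h := congrArg (d⁄dX ℚ) catalanGF_mul
  have h2 : d⁄dX ℚ (2 : ℚ⟦X⟧) = 0 := by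
    rw [← map_ofNat (C (R := ℚ)) 2, derivative_C]
  simp only [Derivation.leibniz, map_add, derivative_one, derivative_sqrt, smul_eq_mul, h2] at h
  apply mul_left_cancel₀ two_ne_zero_series
  linear_combination catalanGF * h - d⁄dX ℚ catalanGF * catalanGF_mul

theorem derivative_two_catalanGF : d⁄dX ℚ (d⁄dX ℚ catalanGF) =
    2 * (catalanGF ^ 3 * invSqrt ^ 2) + 2 * (catalanGF ^ 2 * invSqrt ^ 3) := by
  simp only [derivative_catalanGF, Derivation.leibniz, Derivation.leibniz_pow, derivative_invSqrt,
    smul_eq_mul, nsmul_eq_mul]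
  push_cast
  ring

theorem derivative_three_catalanGF : d⁄dX ℚ (d⁄dX ℚ (d⁄dX ℚ catalanGF)) =
    6 * (catalanGF ^ 4 * invSqrt ^ 3) + 12 * (catalanGF ^ 3 * invSqrt ^ 4) +
      12 * (catalanGF ^ 2 * invSqrt ^ 5) := by
  rw [derivative_two_catalanGF, two_mul, two_mul]
  simp only [map_add, derivative_catalanGF, Derivation.leibniz, Derivation.leibniz_pow,
    derivative_invSqrt, smul_eq_mul, nsmul_eq_mul]
  push_cast
  ring

theorem derivative_linear_weight :
    d⁄dX ℚ (X * catalanGF * (invSqrt ^ 2 - invSqrt)) =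
      invSqrt * (invSqrt ^ 2 - invSqrt) +
        X * catalanGF * (4 * invSqrt ^ 4 - 2 * invSqrt ^ 3) := by
  rw [Derivation.leibniz, derivative_X_mul_catalanGF]
  simp only [map_sub, Derivation.leibniz_pow, derivative_invSqrt, smul_eq_mul, nsmul_eq_mul]
  push_cast
  ring

/-- Multiplying coefficients by n(n-1)(n-2) is x³D³, and multiplying them by n - 1 is xD - 1. -/
theorem six_mul_generatingFunction :
    6 * PowerSeries.mk (fun n : ℕ => (totalPatternCount perm321 (avoiders n perm123) : ℚ)) =
      X ^ 3 * d⁄dX ℚ (d⁄dX ℚ (d⁄dX ℚ catalanGF))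
        - 3 * (X * d⁄dX ℚ (X * catalanGF * (invSqrt ^ 2 - invSqrt))
          - X * catalanGF * (invSqrt ^ 2 - invSqrt))
        + X * catalanGF * (3 * invSqrt ^ 3 - 3 * invSqrt ^ 2) := by
  ext n
  have h1 : coeff n catalanGF = treeCount n 0 := by simpa using coeff_catalanGF_pow n 0
  rw [← map_ofNat (C (R := ℚ)) 6, coeff_C_mul, coeff_mk, six_mul_totalPatternCount, map_add,
    map_sub, coeff_X_pow_three_mul_derivative, h1, coeff_treeWeight_quadratic,
    ← map_ofNat (C (R := ℚ)) 3, coeff_C_mul, map_sub, coeff_X_mul_derivative,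
    coeff_treeWeight_linear]
  ring

/-- In terms of y = xC both x and s are polynomials in y, so c can be eliminated and the only
relation left is (1 - 2y)t = 1. -/
theorem closed_form_identity {R : Type*} [CommRing R] (x c s t y : R) (hy : y = x * c)
    (hx : x = y - y ^ 2) (hs : s = 1 - 2 * y) (hst : s * t = 1) :
    2 * x * (x ^ 3 * (6 * (c ^ 4 * t ^ 3) + 12 * (c ^ 3 * t ^ 4) + 12 * (c ^ 2 * t ^ 5))
        - 3 * (x * (t * (t ^ 2 - t) + x * c * (4 * t ^ 4 - 2 * t ^ 3)) - x * c * (t ^ 2 - t))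
        + x * c * (3 * t ^ 3 - 3 * t ^ 2)) =
      6 * ((8 * x ^ 3 - 20 * x ^ 2 + 8 * x - 1) * t ^ 4 -
        (36 * x ^ 3 - 34 * x ^ 2 + 10 * x - 1) * t ^ 5) := by
  have h1 : 2 * x * (x ^ 3 * (6 * (c ^ 4 * t ^ 3) + 12 * (c ^ 3 * t ^ 4) + 12 * (c ^ 2 * t ^ 5))
        - 3 * (x * (t * (t ^ 2 - t) + x * c * (4 * t ^ 4 - 2 * t ^ 3)) - x * c * (t ^ 2 - t))
        + x * c * (3 * t ^ 3 - 3 * t ^ 2)) =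
      12 * y ^ 4 * t ^ 3 + 24 * x * y ^ 3 * t ^ 4 + 24 * x ^ 2 * y ^ 2 * t ^ 5
        - 6 * x * (x * (t * (t ^ 2 - t) + y * (4 * t ^ 4 - 2 * t ^ 3)) - y * (t ^ 2 - t))
        + 2 * x * y * (3 * t ^ 3 - 3 * t ^ 2) := by
    rw [hy]; ring
  rw [h1]
  clear h1 hy
  subst hs hx
  -- The coefficient is the quotient of the difference of the two sides by (1 - 2y)t - 1.
  linear_combination (6 * y ^ 2 * t - 6 * y ^ 3 * t - 6 * y ^ 3 * t ^ 2 + 6 * y ^ 4 * t ^ 2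
    - 24 * y ^ 3 * t ^ 3 + 36 * y ^ 4 * t ^ 3 - 24 * y ^ 5 * t ^ 3 - 6 * t ^ 4 + 48 * y * t ^ 4
    - 168 * y ^ 2 * t ^ 4 + 288 * y ^ 3 * t ^ 4 - 252 * y ^ 4 * t ^ 4 + 96 * y ^ 5 * t ^ 4) * hst

theorem inv_sqrt_pow_five : (sqrtOneSubFourX ^ 5)⁻¹ = invSqrt ^ 5 := by
  symm
  rw [PowerSeries.eq_inv_iff_mul_eq_one (by simp [constantCoeff_sqrtOneSubFourX]), ← mul_pow,
    mul_comm, sqrt_mul_invSqrt, one_pow]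

theorem inv_one_sub_four_X_sq : ((1 - 4 * X : ℚ⟦X⟧) ^ 2)⁻¹ = invSqrt ^ 4 := by
  symm
  rw [← sqrtOneSubFourX_sq, ← pow_mul,
    PowerSeries.eq_inv_iff_mul_eq_one (by simp [constantCoeff_sqrtOneSubFourX]), ← mul_pow,
    mul_comm, sqrt_mul_invSqrt, one_pow]

theorem mainTheorem5 :
    2 * (PowerSeries.X : PowerSeries ℚ) *
        PowerSeries.mk (fun n : ℕ => (totalPatternCount perm321 (avoiders n perm123) : ℚ)) =
      (8 * PowerSeries.X ^ 3 - 20 * PowerSeries.X ^ 2 + 8 * PowerSeries.X - 1) *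
          ((1 - 4 * PowerSeries.X) ^ 2)⁻¹ -
        (36 * PowerSeries.X ^ 3 - 34 * PowerSeries.X ^ 2 + 10 * PowerSeries.X - 1) *
          (sqrtOneSubFourX ^ 5)⁻¹ := by
  have h6 : (6 : ℚ⟦X⟧) ≠ 0 := by
    intro h
    have := congrArg constantCoeff h
    rw [map_ofNat, map_zero] at this
    norm_num at this
  have hgf := six_mul_generatingFunction
  rw [derivative_three_catalanGF, derivative_linear_weight] at hgf
  have hid := closed_form_identity (X : ℚ⟦X⟧) catalanGF sqrtOneSubFourX invSqrt (X * catalanGF) rfl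
    (by linear_combination -X * catalanGF_eq) (by linear_combination two_X_mul_catalanGF)
    sqrt_mul_invSqrt
  rw [inv_sqrt_pow_five, inv_one_sub_four_X_sq]
  apply mul_left_cancel₀ h6
  linear_combination 2 * X * hgf + hid
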